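/- Let $M$ be a compact connected smooth manifold without boundary, of dimension $d$. Let $\mathrm{SCL}(M)$ be the set of semiconcave functions (with linear modulus) on $M$, that is, of functions $\phi:M\to\mathbb{R}$ of the form $\phi=\inf_i\phi_i$ (pointwise), where $\{\phi_i\}$ is a family of $C^2$ functions on $M$ whose Hessians are uniformly bounded above: around every point of $M$ there are local coordinates, a neighbourhood and a constant $C$ such that $D^2\phi_i\leqslant C\,I$ in these coordinates on this neighbourhood, for all $i$. For $\phi\in\mathrm{SCL}(M)$ and $x\in M$ let $D^+\phi(x)\subseteq T_x^*M$ be the proximal superdifferential of $\phi$ at $x$: the (convex, non-empty) set of covectors $p$ for which there is a constant $C$ such that, in local coordinates around $x$, $$\phi(y)\leqslant\phi(x)+\langle p,y-x\rangle+\frac{C}{2}|y-x|^2\qquad\text{for all } y \text{ near } x.$$ For $0\leqslant k\leqslant d$ put $$\Sigma^{\geqslant k}(\phi)=\{x\in M:\dim D^+\phi(x)\geqslant k\},$$ where $\dim$ is the dimension of a convex set (the dimension of its affine hull). Then, for every $\phi\in\mathrm{SCL}(M)$ and every $k=0,\dots,d$, $$\mathrm{ind}\,(\Sigma^{\geqslant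 k}(\phi))\leqslant d-k,$$ where $\mathrm{ind}$ denotes the small inductive dimension of a topological space ($\mathrm{ind}\,\varnothing=-1$; $\mathrm{ind}\,X\leqslant n$ if every point of $X$ has arbitrarily small open neighbourhoods $U$ with $\mathrm{ind}\,\partial U\leqslant n-1$) and $\Sigma^{\geqslant k}(\phi)$ carries the subspace topology. -/

import Mathlib

open scoped Manifold ContDiff Topology

namespace Semiconcave

variable (d : ℕ) {M : Type*} [TopologicalSpace M] [ChartedSpace (EuclideanSpace ℝ (Fin d)) M]

/-- The Hessians of the functions in the family `F` are uniformly bounded above: around every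
point `x₀`, in the coordinates given by the chart at `x₀`, there are one constant `C` and one
neighbourhood of `x₀` on which `D²f ≤ C I` for all `f ∈ F` simultaneously. On a compact manifold
finitely many such neighbourhoods suffice, so that the bound is uniform on the whole manifold. -/
def HessianBddAbove (F : Set (M → ℝ)) : Prop :=
  ∀ x₀ : M, ∃ C : ℝ, ∀ᶠ y in 𝓝 x₀, ∀ f ∈ F, ∀ v : EuclideanSpace ℝ (Fin d),
    iteratedFDeriv ℝ 2 (f ∘ (chartAt (EuclideanSpace ℝ (Fin d)) x₀).symm)
      (chartAt (EuclideanSpace ℝ (Fin d)) x₀ y) ![v, v] ≤ C * ‖v‖ ^ 2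

/-- `SCL d M` is the set of semiconcave functions (with linear modulus) on the closed
`d`-dimensional manifold `M`: the pointwise infima `φ = inf_i φ_i` of families of `C²` functions
on `M` whose Hessians are uniformly bounded above. -/
def SCL (M : Type*) [TopologicalSpace M] [ChartedSpace (EuclideanSpace ℝ (Fin d)) M] :
    Set (M → ℝ) :=
  {φ | ∃ F : Set (M → ℝ),
    (∀ f ∈ F, ContMDiff (𝓡 d) 𝓘(ℝ, ℝ) 2 f) ∧
    HessianBddAbove d F ∧
    ∀ x : M, IsGLB ((fun f : M → ℝ => f x) '' F) (φ x)}

/-- The proximal superdifferential `D⁺φ(x)`, a set of covectors at `x`: `p ∈ D⁺φ(x)` if, for some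
`C` and all `y` near `x`, one has `φ(y) ≤ φ(x) + ⟨p, y - x⟩ + (C / 2) |y - x|²` in the coordinates
given by the chart at `x` (through which `TangentSpace (𝓡 d) x` is identified with `ℝᵈ`). -/
def superdifferential (φ : M → ℝ) (x : M) : Set (TangentSpace (𝓡 d) x →L[ℝ] ℝ) :=
  {p | ∃ C : ℝ, ∀ᶠ y in 𝓝 x,
    φ y ≤ φ x
      + p (chartAt (EuclideanSpace ℝ (Fin d)) x y - chartAt (EuclideanSpace ℝ (Fin d)) x x :
          EuclideanSpace ℝ (Fin d))
      + C / 2 * ‖chartAt (EuclideanSpace ℝ (Fin d)) x y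
          - chartAt (EuclideanSpace ℝ (Fin d)) x x‖ ^ 2}

/-- `dim D⁺φ(x)`: the dimension of the convex set `D⁺φ(x)`, i.e. of its affine hull. (The set is
never empty for semiconcave `φ`.) -/
noncomputable def dimSuperdifferential (φ : M → ℝ) (x : M) : ℕ :=
  Module.finrank ℝ (vectorSpan ℝ (superdifferential d φ x))

/-- `Σ^{≥ k}(φ) = {x ∈ M | dim D⁺φ(x) ≥ k}`. -/
def sigmaGE (k : ℕ) (φ : M → ℝ) : Set M :=
  {x | k ≤ dimSuperdifferential d φ x}

end Semiconcave

namespace Semiconcave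

open MeasureTheory Set Filter Topology

/-! ### Small inductive dimension: subspaces and locality. -/

section Dimension

universe u v

/-! In a chart, fix `m` and consider pairs `(z, w)` with `w` a supergradient at `z` with constant
`m`. For nearby base points, the Minty map `(z, w) ↦ (2m+1)z - w` does not decrease the distance of
base points, so `z` is locally a 1-Lipschitz function of the image. If the supergradients at `z`
have dimension at least `k`, their image is convex of dimension at least `k` and meets one of
countably many fixed affine subspaces of codimension `k`. Hence the singular set is a countable
union of Lipschitz images of sets null in Hausdorff dimension `d - k + 1`
(`hausdorffMeasure_setOf_le_finrank_proximalSupergradients`). A set null in dimension `n` has `ind <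
n`, as almost every small sphere meets it in a set null in dimension `n - 1`
(`hasSmallInductiveDimensionLT_of_hausdorffMeasure_range`). Locality of `ind` then passes from
charts to `M`. -/

theorem hasSmallInductiveDimensionLT_of_isInducing {n : ℕ} {X : Type u} {Y : Type v}
    [TopologicalSpace X] [TopologicalSpace Y] {f : X → Y} (hf : IsInducing f)
    (h : HasSmallInductiveDimensionLT Y n) : HasSmallInductiveDimensionLT X n := by
  induction n generalizing X Y with
  | zero =>
    rw [hasSmallInductiveDimensionLT_zero_iff] at h ⊢
    exact Function.isEmpty f
  | succ n ih =>
    cases h with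
    | succ _ s hs h =>
      refine .succ n _ (hs.isInducing hf) ?_
      rintro _ ⟨B, hB, rfl⟩
      have hmaps : MapsTo f (frontier (f ⁻¹' B)) (frontier B) :=
        fun x hx => hf.continuous.frontier_preimage_subset B hx
      have hind : IsInducing (hmaps.restrict f _ _) :=
        .of_comp (hf.continuous.restrict hmaps) continuous_subtype_val
          (hf.comp IsInducing.subtypeVal)
      exact ih hind (h B hB)

/-- Having small inductive dimension `< n` is a local property of regular spaces. -/
theorem hasSmallInductiveDimensionLT_of_locally {n : ℕ} {X : Type u} [TopologicalSpace X]
    [RegularSpace X]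
    (h : ∀ x : X, ∃ U : Set X, IsOpen U ∧ x ∈ U ∧ HasSmallInductiveDimensionLT U n) :
    HasSmallInductiveDimensionLT X n := by
  cases n with
  | zero =>
    rw [hasSmallInductiveDimensionLT_zero_iff]
    refine ⟨fun x => ?_⟩
    obtain ⟨U, -, hxU, hU⟩ := h x
    exact (hasSmallInductiveDimensionLT_zero_iff.1 hU).false ⟨x, hxU⟩
  | succ n =>
    refine .succ n {V | IsOpen V ∧ HasSmallInductiveDimensionLT (frontier V) n} ?_
      fun V hV => hV.2
    refine TopologicalSpace.isTopologicalBasis_of_isOpen_of_nhds (fun V hV => hV.1) ?_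
    intro x W hxW hW
    obtain ⟨U, hU, hxU, hdim⟩ := h x
    -- A closed `K` inside `U` keeps the frontier taken in `X` within `U`, where it agrees with the
    -- frontier taken in `U`.
    obtain ⟨K, hK, hKc, hKU⟩ := exists_mem_nhds_isClosed_subset ((hU.inter hW).mem_nhds ⟨hxU, hxW⟩)
    cases hdim with
    | succ _ s hs hfr =>
      obtain ⟨B, hBs, hxB, hBK⟩ := hs.mem_nhds_iff.1
        (show ((↑) : U → X) ⁻¹' K ∈ 𝓝 (⟨x, hxU⟩ : U) from
          continuous_subtype_val.continuousAt.preimage_mem_nhds hK)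
      have hBK' : ((↑) : U → X) '' B ⊆ K := image_subset_iff.2 hBK
      have hcl : closure (((↑) : U → X) '' B) ⊆ K := closure_minimal hBK' hKc
      refine ⟨(↑) '' B, ⟨hU.isOpenMap_subtype_val _ (hs.isOpen hBs), ?_⟩, ⟨_, hxB, rfl⟩,
        fun y hy => (hKU (hBK' hy)).2⟩
      have hsub : ∀ y ∈ frontier (((↑) : U → X) '' B), y ∈ U :=
        fun y hy => (hKU (hcl hy.1)).1
      have hmem : ∀ y : frontier (((↑) : U → X) '' B),
          (⟨y, hsub y y.2⟩ : U) ∈ frontier B := by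
        intro y
        have := hU.isOpenMap_subtype_val.preimage_frontier_eq_frontier_preimage
          continuous_subtype_val (((↑) : U → X) '' B)
        rw [preimage_image_eq _ Subtype.val_injective] at this
        rw [← this]
        exact y.2
      refine hasSmallInductiveDimensionLT_of_isInducing
        (f := fun y => (⟨⟨y, hsub y y.2⟩, hmem y⟩ : frontier B)) ?_ (hfr B hBs)
      refine IsInducing.of_comp (g := fun z : frontier B => ((z : U) : X)) ?_ ?_ ?_
      · exact Continuous.subtype_mk (Continuous.subtype_mk continuous_subtype_val _) _
      · fun_prop
      · exact IsInducing.subtypeVal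

end Dimension

/-! ### Null sets for Hausdorff measure have small dimension. -/

section Hausdorff

variable {E : Type*} [MetricSpace E] [MeasurableSpace E] [BorelSpace E]

/-- Null case of Eilenberg's inequality: almost every level set of a `1`-Lipschitz function on an
`(n + 1)`-null set is `n`-null. -/
theorem ae_hausdorffMeasure_inter_fiber_eq_zero {n : ℕ} {s : Set E} (hs : μH[(n + 1 : ℕ)] s = 0)
    {f : E → ℝ} (hf : LipschitzWith 1 f) :
    ∀ᵐ r : ℝ, μH[n] (s ∩ f ⁻¹' {r}) = 0 := by
  obtain ⟨δ, hδ, hδsum⟩ := ENNReal.exists_pos_sum_of_countable one_ne_zero ℕ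
  have hcover : ∀ j : ℕ, ∃ t : ℕ → Set E, s ⊆ ⋃ i, t i ∧ (∀ i, Metric.ediam (t i) ≤ δ j) ∧
      ∑' i, ⨆ _ : (t i).Nonempty, Metric.ediam (t i) ^ ((n + 1 : ℕ) : ℝ) < δ j := by
    intro j
    have hj : (0 : ENNReal) < δ j := by exact_mod_cast hδ j
    rw [Measure.hausdorffMeasure_apply] at hs
    have h0 := ((le_iSup₂ (α := ENNReal) (f := fun (r : ENNReal) (_ : 0 < r) =>
      ⨅ (t : ℕ → Set E) (_ : s ⊆ ⋃ n, t n) (_ : ∀ n, Metric.ediam (t n) ≤ r),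
          ∑' i, ⨆ _ : (t i).Nonempty, Metric.ediam (t i) ^ ((n + 1 : ℕ) : ℝ)) (δ j : ENNReal) hj).trans
            hs.le).trans_lt hj
    simp only [iInf_lt_iff] at h0
    obtain ⟨t, h1, h2, h3⟩ := h0
    exact ⟨t, h1, h2, h3⟩
  choose t hst htδ htsum using hcover
  -- `g j r` bounds the `n`-dimensional sum of the pieces meeting the level `r`; integrating in `r`
  -- costs one more diameter per piece. The `δ j` are summable, so `g j r → 0` for almost every `r`.
  -- Closures serve measurability.
  let g : ℕ → ℝ → ENNReal := fun j r =>
    ∑' i, (closure (f '' t j i)).indicator (fun _ => Metric.ediam (t j i) ^ (n : ℝ)) r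
  have hgmeas : ∀ j, Measurable (g j) := fun j =>
    Measurable.tsum fun i => measurable_const.indicator isClosed_closure.measurableSet
  have hgint : ∀ j, ∫⁻ r, g j r ≤ δ j := by
    intro j
    refine le_trans ?_ (htsum j).le
    rw [lintegral_tsum fun i =>
      (measurable_const.indicator isClosed_closure.measurableSet).aemeasurable]
    refine ENNReal.tsum_le_tsum fun i => ?_
    rw [lintegral_indicator isClosed_closure.measurableSet, setLIntegral_const]
    rcases (t j i).eq_empty_or_nonempty with he | hne
    · simp [he]
    · simp only [hne, iSup_pos]
      rw [ENNReal.rpow_natCast, ENNReal.rpow_natCast, pow_succ]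
      gcongr
      refine (Real.volume_le_diam _).trans ?_
      rw [Metric.ediam_closure]
      simpa using hf.ediam_image_le (t j i)
  have hfin : ∫⁻ r, ∑' j, g j r ≠ ⊤ := by
    rw [lintegral_tsum fun j => (hgmeas j).aemeasurable]
    exact ((ENNReal.tsum_le_tsum hgint).trans_lt (hδsum.trans ENNReal.one_lt_top)).ne
  filter_upwards [ae_lt_top (Measurable.tsum hgmeas) hfin] with r hr
  have hg0 : Tendsto (fun j => g j r) atTop (𝓝 0) := by
    simpa [Nat.cofinite_eq_atTop] using ENNReal.tendsto_cofinite_zero_of_tsum_ne_top hr.ne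
  have hδ0 : Tendsto (fun j => (δ j : ENNReal)) atTop (𝓝 0) := by
    simpa [Nat.cofinite_eq_atTop] using
      ENNReal.tendsto_cofinite_zero_of_tsum_ne_top (hδsum.trans ENNReal.one_lt_top).ne
  refine le_antisymm ?_ (zero_le)
  refine (Measure.hausdorffMeasure_le_liminf_tsum (n : ℝ) _ _ hδ0
    (fun j (i : {i : ℕ | r ∈ closure (f '' t j i)}) => t j i)
    (.of_forall fun j i => htδ j i) (.of_forall fun j => ?_)).trans ?_
  · rintro y ⟨hys, hyr⟩
    obtain ⟨i, hi⟩ := mem_iUnion.1 (hst j hys)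
    exact mem_iUnion.2 ⟨⟨i, subset_closure ⟨y, hi, hyr⟩⟩, hi⟩
  · refine le_of_eq (Eq.trans ?_ hg0.liminf_eq)
    congr 1
    ext j
    rw [tsum_subtype {i : ℕ | r ∈ closure (f '' t j i)}
      (fun i => Metric.ediam (t j i) ^ (n : ℝ))]
    rfl

/-- A space that embeds into a metric space with `n`-null image has small inductive
dimension `< n`. -/
theorem hasSmallInductiveDimensionLT_of_hausdorffMeasure_range {n : ℕ} {X : Type*}
    [TopologicalSpace X] {f : X → E} (hf : IsInducing f) (h : μH[n] (range f) = 0) :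
    HasSmallInductiveDimensionLT X n := by
  induction n generalizing X with
  | zero =>
    rw [hasSmallInductiveDimensionLT_zero_iff]
    refine ⟨fun x => ?_⟩
    have h1 : μH[0] ({f x} : Set E) ≤ μH[((0 : ℕ) : ℝ)] (range f) := by
      rw [Nat.cast_zero]
      exact measure_mono (singleton_subset_iff.2 ⟨x, rfl⟩)
    rw [Measure.hausdorffMeasure_zero_singleton, h] at h1
    exact absurd h1 (by simp)
  | succ n ih =>
    refine .succ n {V | IsOpen V ∧ HasSmallInductiveDimensionLT (frontier V) n} ?_
      fun V hV => hV.2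
    refine TopologicalSpace.isTopologicalBasis_of_isOpen_of_nhds (fun V hV => hV.1) ?_
    intro x W hxW hW
    obtain ⟨O, hO, rfl⟩ := hf.isOpen_iff.1 hW
    obtain ⟨ε, hε, hεO⟩ := Metric.isOpen_iff.1 hO (f x) hxW
    have hae := ae_hausdorffMeasure_inter_fiber_eq_zero h (LipschitzWith.dist_left (f x))
    obtain ⟨r, ⟨hr0, hrε⟩, hr⟩ : ∃ r ∈ Ioo 0 ε,
        μH[n] (range f ∩ (fun y => dist y (f x)) ⁻¹' {r}) = 0 := by
      by_contra! hcon
      have : volume (Ioo 0 ε) = 0 :=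
        measure_mono_null (fun r hr => hcon r hr) (ae_iff.1 hae)
      simp [hε.not_ge] at this
    refine ⟨f ⁻¹' Metric.ball (f x) r, ⟨Metric.isOpen_ball.preimage hf.continuous, ?_⟩,
      Metric.mem_ball_self hr0, fun y hy => hεO (Metric.ball_subset_ball hrε.le hy)⟩
    refine ih (f := fun y : frontier (f ⁻¹' Metric.ball (f x) r) => f y)
      (hf.comp IsInducing.subtypeVal) (measure_mono_null ?_ hr)
    rintro _ ⟨y, rfl⟩
    exact ⟨⟨y, rfl⟩, Metric.frontier_ball_subset_sphere
      (hf.continuous.frontier_preimage_subset _ y.2)⟩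

end Hausdorff

/-! ### Convex sets and countable families of affine subspaces. -/

section Convex

variable {E : Type*} [NormedAddCommGroup E] [NormedSpace ℝ E] [FiniteDimensional ℝ E]

/-- The dimension of the union of an increasing sequence of sets is reached along the sequence. -/
theorem exists_vectorSpan_iUnion_le {S : ℕ → Set E} (hS : Monotone S) :
    ∃ m, vectorSpan ℝ (⋃ n, S n) ≤ vectorSpan ℝ (S m) := by
  obtain ⟨m, hm⟩ := wellFoundedGT_iff_monotone_chain_condition.1 inferInstance
    (⟨fun n => vectorSpan ℝ (S n), fun a b hab => vectorSpan_mono ℝ (hS hab)⟩ : ℕ →o Submodule ℝ E)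
  refine ⟨m, Submodule.span_le.2 ?_⟩
  rintro _ ⟨x, hx, y, hy, rfl⟩
  obtain ⟨i, hi⟩ := mem_iUnion.1 hx
  obtain ⟨j, hj⟩ := mem_iUnion.1 hy
  have h1 : x ∈ S (m + (i + j)) := hS (by omega) hi
  have h2 : y ∈ S (m + (i + j)) := hS (by omega) hj
  have := hm (m + (i + j)) (by omega)
  change vectorSpan ℝ (S m) = vectorSpan ℝ (S (m + (i + j))) at this
  rw [this]
  exact vsub_mem_vectorSpan ℝ h1 h2

/-- Nonempty convex sets of dimension at least `dim F` meet one of countably many affine subspaces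
of codimension `dim F`, given by the fibers of a dense sequence of linear maps to `F` over a dense
sequence of points. -/
theorem Convex.exists_mem_eq_of_denseRange {F : Type*} [NormedAddCommGroup F] [NormedSpace ℝ F]
    [FiniteDimensional ℝ F] {S : Set E} (hS : Convex ℝ S) (hne : S.Nonempty)
    (hdim : Module.finrank ℝ F ≤ Module.finrank ℝ (vectorSpan ℝ S))
    {L : ℕ → E →L[ℝ] F} (hL : DenseRange L) {q : ℕ → F} (hq : DenseRange q) :
    ∃ i j, Function.Surjective (L i) ∧ ∃ w ∈ S, L i w = q j := by
  obtain ⟨s, hs⟩ := finrank_le_iff_exists_linearMap.1 hdim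
  obtain ⟨g, hg⟩ := s.exists_leftInverse_of_injective (LinearMap.ker_eq_bot.2 hs)
  obtain ⟨G, hG⟩ := g.exists_extend
  let σ : F →L[ℝ] E := ((vectorSpan ℝ S).subtype ∘ₗ s).toContinuousLinearMap
  -- Being invertible along `σ` is an open condition, so the dense sequence has a member mapping the
  -- direction of `S` onto `F`.
  have hopen : IsOpen {A : E →L[ℝ] F | IsUnit (A ∘L σ)} :=
    Units.isOpen.preimage ((ContinuousLinearMap.compL ℝ F E F).flip σ).continuous
  have hmem : G.toContinuousLinearMap ∈ {A : E →L[ℝ] F | IsUnit (A ∘L σ)} := by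
    have : G.toContinuousLinearMap ∘L σ = 1 := by
      ext x
      have h1 := LinearMap.congr_fun hG (s x)
      have h2 := LinearMap.congr_fun hg x
      simp only [LinearMap.comp_apply, LinearMap.id_apply] at h1 h2
      simpa [σ, h2] using h1
    simp [this]
  obtain ⟨i, hi⟩ := hL.exists_mem_open hopen ⟨_, hmem⟩
  have hsurj : ∀ y, ∃ v ∈ vectorSpan ℝ S, L i v = y := by
    intro y
    obtain ⟨U, hU⟩ := hi
    refine ⟨s ((↑U⁻¹ : F →L[ℝ] F) y), (s _).2, ?_⟩
    have := congrArg (fun A : F →L[ℝ] F => A y) U.mul_inv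
    rw [hU] at this
    simpa [σ] using this
  have hspan : vectorSpan ℝ (L i '' S) = ⊤ := by
    have := (L i).toLinearMap.toAffineMap.map_vectorSpan (s := S)
    change Submodule.map _ _ = vectorSpan ℝ (L i '' S) at this
    rw [← this, Submodule.eq_top_iff']
    intro y
    obtain ⟨v, hv, rfl⟩ := hsurj y
    exact ⟨v, hv, rfl⟩
  have hint : (interior (L i '' S)).Nonempty := by
    have hconv : Convex ℝ (L i '' S) := hS.linear_image (L i).toLinearMap
    rw [hconv.interior_nonempty_iff_affineSpan_eq_top]
    exact (AffineSubspace.affineSpan_eq_top_iff_vectorSpan_eq_top_of_nonempty ℝ F F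
      (hne.image _)).2 hspan
  obtain ⟨j, hj⟩ := hq.exists_mem_open isOpen_interior hint
  obtain ⟨w, hw, hwj⟩ := interior_subset hj
  exact ⟨i, j, fun y => (hsurj y).imp fun v hv => hv.2, w, hw, hwj⟩

/-- The fiber is a translate of the kernel, whose dimension is below `n` by rank-nullity. -/
theorem hausdorffMeasure_fiber_eq_zero [MeasurableSpace E] [BorelSpace E]
    {F : Type*} [NormedAddCommGroup F] [NormedSpace ℝ F]
    {L : E →L[ℝ] F} (hL : Function.Surjective L) (q : F) {n : ℕ}
    (hn : Module.finrank ℝ E < n + Module.finrank ℝ F) :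
    μH[n] (L ⁻¹' {q}) = 0 := by
  obtain ⟨t₀, rfl⟩ := hL q
  have hsub : L ⁻¹' {L t₀} ⊆ (fun v : LinearMap.ker L.toLinearMap => t₀ + (v : E)) '' univ := by
    intro t ht
    refine ⟨⟨t - t₀, ?_⟩, mem_univ _, by simp⟩
    have : L t = L t₀ := ht
    simp [this]
  have hlip : LipschitzWith 1 (fun v : LinearMap.ker L.toLinearMap => t₀ + (v : E)) :=
    LipschitzWith.of_dist_le_mul fun v w => by simp [Subtype.dist_eq]
  refine measure_mono_null hsub (le_antisymm ?_ zero_le)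
  refine (hlip.hausdorffMeasure_image_le n.cast_nonneg univ).trans ?_
  have hk : Module.finrank ℝ (LinearMap.ker L.toLinearMap) < n := by
    have h1 := L.toLinearMap.finrank_range_add_finrank_ker
    rw [LinearMap.range_eq_top.2 hL, finrank_top] at h1
    omega
  rw [Real.hausdorffMeasure_of_finrank_lt (by exact_mod_cast hk)]
  simp

end Convex

/-- A relation whose inverse is `1`-Lipschitz transports null sets to null sets. -/
theorem hausdorffMeasure_setOf_exists_rel_eq_zero {X Y : Type*} [MetricSpace X]
    [MeasurableSpace X] [BorelSpace X] [MetricSpace Y] [MeasurableSpace Y] [BorelSpace Y]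
    {R : X → Y → Prop}
    (hR : ∀ x t x' t', R x t → R x' t' → dist x x' ≤ dist t t')
    {N : Set Y} {n : ℕ} (hN : μH[n] N = 0) : μH[n] {x | ∃ t ∈ N, R x t} = 0 := by
  classical
  rcases isEmpty_or_nonempty X with hX | hX
  · rw [Set.eq_empty_of_isEmpty {x | ∃ t ∈ N, R x t}, measure_empty]
  let P : Y → X := fun t => if h : ∃ x, R x t then h.choose else Classical.arbitrary X
  have hP : ∀ t, (∃ x, R x t) → R (P t) t := by
    intro t h
    simp only [P, dif_pos h]
    exact h.choose_spec
  have hlip : LipschitzOnWith 1 P (N ∩ {t | ∃ x, R x t}) :=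
    LipschitzOnWith.of_dist_le_mul fun t ht t' ht' => by
      simpa using hR _ _ _ _ (hP t ht.2) (hP t' ht'.2)
  have hsub : {x | ∃ t ∈ N, R x t} ⊆ P '' (N ∩ {t | ∃ x, R x t}) := by
    rintro x ⟨t, htN, hxt⟩
    -- The Lipschitz bound with `t = t'` makes the related point unique, so the choice `P t` is `x`.
    refine ⟨t, ⟨htN, x, hxt⟩, ?_⟩
    have := hR _ _ _ _ (hP t ⟨x, hxt⟩) hxt
    rwa [dist_self, dist_le_zero] at this
  refine measure_mono_null hsub (le_antisymm ?_ zero_le)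
  refine (hlip.hausdorffMeasure_image_le n.cast_nonneg).trans ?_
  rw [measure_mono_null inter_subset_left hN, mul_zero]

/-! ### Proximal supergradients and the Minty map. -/

section Superdifferential

variable {E : Type*} [NormedAddCommGroup E] [InnerProductSpace ℝ E]

/-- Proximal supergradients of `u` at `z`, as vectors. -/
def proximalSupergradients (u : E → ℝ) (z : E) : Set E :=
  {w | ∃ C : ℝ, ∀ᶠ y in 𝓝 z, u y ≤ u z + inner ℝ w (y - z) + C * ‖y - z‖ ^ 2}

/-- Proximal supergradients of `u` at `z` with constant `m` on the ball of radius `1 / (m + 1)`. -/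
def proximalSupergradientsOn (u : E → ℝ) (m : ℕ) (z : E) : Set E :=
  {w | ∀ y, dist y z < 1 / ((m : ℝ) + 1) → u y ≤ u z + inner ℝ w (y - z) + m * ‖y - z‖ ^ 2}

theorem proximalSupergradientsOn_mono (u : E → ℝ) (z : E) :
    Monotone fun m => proximalSupergradientsOn u m z := by
  intro m n hmn w hw y hy
  have hmn' : (m : ℝ) ≤ n := by exact_mod_cast hmn
  refine (hw y (hy.trans_le (by gcongr))).trans ?_
  gcongr

/-- A large integer both dominates the constant and makes the radius `1 / (m + 1)` small enough. -/
theorem proximalSupergradients_eq_iUnion (u : E → ℝ) (z : E) :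
    proximalSupergradients u z = ⋃ m, proximalSupergradientsOn u m z := by
  ext w
  simp only [mem_iUnion]
  constructor
  · rintro ⟨C, hC⟩
    obtain ⟨ε, hε, hball⟩ := Metric.eventually_nhds_iff.1 hC
    obtain ⟨m₁, hm₁⟩ := exists_nat_ge C
    obtain ⟨m₂, hm₂⟩ := exists_nat_one_div_lt hε
    refine ⟨max m₁ m₂, fun y hy => (hball (hy.trans (lt_of_le_of_lt ?_ hm₂))).trans ?_⟩
    · gcongr
      exact le_max_right _ _
    · gcongr
      exact hm₁.trans (by exact_mod_cast le_max_left _ _)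
  · rintro ⟨m, hm⟩
    exact ⟨m, Metric.eventually_nhds_iff.2 ⟨1 / ((m : ℝ) + 1), by positivity, fun y hy => hm y hy⟩⟩

theorem convex_proximalSupergradientsOn (u : E → ℝ) (m : ℕ) (z : E) :
    Convex ℝ (proximalSupergradientsOn u m z) := by
  intro w hw w' hw' a b ha hb hab y hy
  have h1 := mul_le_mul_of_nonneg_left (hw y hy) ha
  have h2 := mul_le_mul_of_nonneg_left (hw' y hy) hb
  rw [inner_add_left, real_inner_smul_left, real_inner_smul_left]
  have hb' : b = 1 - a := by linarith
  subst hb'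
  linarith

/-- The Minty map is expanding. -/
theorem dist_le_dist_sub_proximalSupergradientsOn {u : E → ℝ} {m : ℕ} {x x' w w' : E}
    (hxx : dist x x' < 1 / ((m : ℝ) + 1)) (hw : w ∈ proximalSupergradientsOn u m x)
    (hw' : w' ∈ proximalSupergradientsOn u m x') :
    dist x x' ≤ dist ((2 * m + 1 : ℝ) • x - w) ((2 * m + 1 : ℝ) • x' - w') := by
  have h1 := hw x' (by rwa [dist_comm])
  have h2 := hw' x hxx
  set v := x - x' with hv
  have hv' : x' - x = -v := by simp [hv]
  rw [hv', norm_neg, inner_neg_right] at h1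
  rw [dist_eq_norm, dist_eq_norm, ← hv]
  have hd : (2 * m + 1 : ℝ) • x - w - ((2 * m + 1 : ℝ) • x' - w')
      = (2 * m + 1 : ℝ) • v - (w - w') := by
    rw [hv, smul_sub]; abel
  rw [hd]
  -- Adding the two inequalities, each tested at the other base point, cancels the values of `u`.
  -- The factor `2m + 1` then leaves a surplus `‖v‖ ^ 2`.
  have h3 : inner ℝ (w - w') v ≤ 2 * m * ‖v‖ ^ 2 := by
    rw [inner_sub_left]; linarith
  have h4 : ‖v‖ ^ 2 ≤ inner ℝ ((2 * m + 1 : ℝ) • v - (w - w')) v := by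
    rw [inner_sub_left, real_inner_smul_left, real_inner_self_eq_norm_sq]
    linarith
  have h5 := h4.trans (real_inner_le_norm _ _)
  rcases (norm_nonneg v).eq_or_lt with h0 | h0
  · rw [← h0]; exact norm_nonneg _
  · rw [sq] at h5
    exact le_of_mul_le_mul_right h5 h0

theorem finrank_vectorSpan_image_const_sub (S : Set E) (c : E) :
    Module.finrank ℝ (vectorSpan ℝ ((fun w => c - w) '' S)) =
      Module.finrank ℝ (vectorSpan ℝ S) := by
  have := (AffineEquiv.constVSub ℝ c).toAffineMap.map_vectorSpan (s := S)
  change Submodule.map _ _ = vectorSpan ℝ ((fun w => c - w) '' S) at this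
  rw [← this]
  exact LinearEquiv.finrank_map_eq (AffineEquiv.constVSub ℝ c).linear _

variable [FiniteDimensional ℝ E] [MeasurableSpace E] [BorelSpace E]

/-- For an arbitrary function `u`, the points at which the proximal supergradients span a space of
dimension at least `k` form a null set for the Hausdorff measure of dimension `dim E - k + 1`. -/
theorem hausdorffMeasure_setOf_le_finrank_proximalSupergradients (u : E → ℝ) (k n : ℕ)
    (hn : Module.finrank ℝ E < n + k) :
    μH[n] {z | k ≤ Module.finrank ℝ (vectorSpan ℝ (proximalSupergradients u z))} = 0 := by
  rcases k.eq_zero_or_pos with rfl | hk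
  -- For `k = 0` the supergradient set may be empty, but here `n` exceeds the dimension of `E`.
  · rw [Real.hausdorffMeasure_of_finrank_lt (by exact_mod_cast hn)]
    rfl
  let F := EuclideanSpace ℝ (Fin k)
  let L := TopologicalSpace.denseSeq (E →L[ℝ] F)
  let q := TopologicalSpace.denseSeq F
  let c := TopologicalSpace.denseSeq E
  -- The half radius puts any two base points for the same `m`, `l` within `1 / (m + 1)`, as the
  -- expansion estimate requires.
  let R : ℕ → ℕ → E → E → Prop := fun m l z t =>
    dist z (c l) < 1 / ((m : ℝ) + 1) / 2 ∧
      ∃ w ∈ proximalSupergradientsOn u m z, (2 * m + 1 : ℝ) • z - w = t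
  have hsub : {z | k ≤ Module.finrank ℝ (vectorSpan ℝ (proximalSupergradients u z))} ⊆
      ⋃ (m : ℕ) (l : ℕ) (i : ℕ) (j : ℕ) (_ : Function.Surjective (L i)),
        {z | ∃ t ∈ L i ⁻¹' {q j}, R m l z t} := by
    intro z hz
    obtain ⟨m, hm⟩ := exists_vectorSpan_iUnion_le (proximalSupergradientsOn_mono u z)
    rw [← proximalSupergradients_eq_iUnion] at hm
    have hdim : k ≤ Module.finrank ℝ (vectorSpan ℝ (proximalSupergradientsOn u m z)) :=
      le_trans hz (Submodule.finrank_mono hm)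
    have hne : (proximalSupergradientsOn u m z).Nonempty := by
      by_contra hcon
      rw [not_nonempty_iff_eq_empty] at hcon
      rw [hcon, vectorSpan_empty, finrank_bot] at hdim
      omega
    rw [← finrank_vectorSpan_image_const_sub _ ((2 * m + 1 : ℝ) • z)] at hdim
    have hconv : Convex ℝ ((fun w => (2 * m + 1 : ℝ) • z - w) '' proximalSupergradientsOn u m z) :=
      (convex_proximalSupergradientsOn u m z).affine_image
        (AffineEquiv.constVSub ℝ ((2 * m + 1 : ℝ) • z)).toAffineMap
    obtain ⟨i, j, hi, t, ⟨w, hw, rfl⟩, ht⟩ := Convex.exists_mem_eq_of_denseRange hconv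
      (hne.image _) (F := F) (by simpa [F] using hdim) (TopologicalSpace.denseRange_denseSeq _)
      (TopologicalSpace.denseRange_denseSeq F)
    obtain ⟨l, hl⟩ := (TopologicalSpace.denseRange_denseSeq E).exists_dist_lt z
      (show (0 : ℝ) < 1 / ((m : ℝ) + 1) / 2 by positivity)
    simp only [mem_iUnion]
    exact ⟨m, l, i, j, hi, _, ht, hl, w, hw, rfl⟩
  refine measure_mono_null hsub ?_
  simp only [measure_iUnion_null_iff]
  intro m l i j hi
  refine hausdorffMeasure_setOf_exists_rel_eq_zero ?_
    (hausdorffMeasure_fiber_eq_zero hi (q j) (by simpa [F] using hn))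
  rintro x _ x' _ ⟨hx, w, hw, rfl⟩ ⟨hx', w', hw', rfl⟩
  refine dist_le_dist_sub_proximalSupergradientsOn ?_ hw hw'
  linarith [dist_triangle_right x x' (c l)]

end Superdifferential

/-- The first order Taylor expansion of a `C²` function with a quadratic error term. -/
theorem exists_norm_sub_sub_le_of_contDiffAt {E F : Type*} [NormedAddCommGroup E]
    [NormedSpace ℝ E] [NormedAddCommGroup F] [NormedSpace ℝ F] {f : E → F} {A : E →L[ℝ] F}
    {z : E} (hf : ContDiffAt ℝ 2 f z) (hA : HasFDerivAt f A z) :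
    ∃ K : ℝ, ∀ᶠ y in 𝓝 z, ‖f y - f z - A (y - z)‖ ≤ K * ‖y - z‖ ^ 2 := by
  have hf' : DifferentiableAt ℝ (fderiv ℝ f) z :=
    (hf.fderiv_right (m := 1) le_rfl).differentiableAt one_ne_zero
  obtain ⟨K, hK⟩ := hf'.isBigO_sub.bound
  have hdiff : ∀ᶠ y in 𝓝 z, DifferentiableAt ℝ f y :=
    (hf.eventually (by simp)).mono fun y hy => hy.differentiableAt two_ne_zero
  obtain ⟨ε, hε, hball⟩ := Metric.eventually_nhds_iff.1 (hK.and hdiff)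
  refine ⟨|K|, Metric.eventually_nhds_iff.2 ⟨ε, hε, fun y hy => ?_⟩⟩
  have hlt : ∀ w ∈ Metric.closedBall z (dist y z), dist w z < ε :=
    fun w hw => (Metric.mem_closedBall.1 hw).trans_lt hy
  have := (convex_closedBall z (dist y z)).norm_image_sub_le_of_norm_hasFDerivWithin_le'
    (f := f) (f' := fderiv ℝ f) (φ := A) (C := |K| * ‖y - z‖) (x := z) (y := y)
    (fun w hw => (hball (hlt w hw)).2.hasFDerivAt.hasFDerivWithinAt) (fun w hw => ?_)
    (Metric.mem_closedBall_self dist_nonneg) (Metric.mem_closedBall.2 le_rfl)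
  · rwa [sq, ← mul_assoc]
  · rw [← hA.fderiv]
    refine (hball (hlt w hw)).1.trans ?_
    rw [← dist_eq_norm y z]
    have := Metric.mem_closedBall.1 hw
    rw [dist_eq_norm] at this
    gcongr
    exact le_abs_self K

/-- The transpose of `A`, from covectors to gradient vectors. -/
noncomputable def transposeGradient {E : Type*} [NormedAddCommGroup E] [InnerProductSpace ℝ E]
    [CompleteSpace E] (A : E →L[ℝ] E) : (E →L[ℝ] ℝ) →ₗ[ℝ] E where
  toFun p := (InnerProductSpace.toDual ℝ E).symm (p ∘L A)
  map_add' p q := by rw [ContinuousLinearMap.add_comp, map_add]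
  map_smul' c p := by rw [ContinuousLinearMap.smul_comp, map_smulₛₗ]; rfl

theorem transposeGradient_injective {E : Type*} [NormedAddCommGroup E] [InnerProductSpace ℝ E]
    [CompleteSpace E] {A : E →L[ℝ] E} (hA : Function.Surjective A) :
    Function.Injective (transposeGradient A) := by
  intro p q hpq
  have h := (InnerProductSpace.toDual ℝ E).symm.injective hpq
  ext v
  obtain ⟨w, rfl⟩ := hA v
  exact congrArg (fun r : E →L[ℝ] ℝ => r w) h

/-! ### Passage to charts. -/

section Manifold

variable (d : ℕ) {M : Type*} [TopologicalSpace M] [ChartedSpace (EuclideanSpace ℝ (Fin d)) M]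
  [IsManifold (𝓡 d) ∞ M]

local notation "𝔼" => EuclideanSpace ℝ (Fin d)

/-- The proximal superdifferential does not depend on the chart: covectors in the chart at `x` are
transported to the chart at `x₀` by the derivative of the coordinate change. -/
theorem transposeGradient_mem_proximalSupergradients {φ : M → ℝ} {x₀ x : M}
    (hx : x ∈ (chartAt 𝔼 x₀).source) {p : 𝔼 →L[ℝ] ℝ} (hp : p ∈ superdifferential d φ x) :
    transposeGradient (tangentCoordChange (𝓡 d) x₀ x x) p ∈
      proximalSupergradients (φ ∘ (chartAt 𝔼 x₀).symm) (chartAt 𝔼 x₀ x) := by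
  set ψ := chartAt 𝔼 x with hψ
  set ψ₀ := chartAt 𝔼 x₀ with hψ₀
  set A : 𝔼 →L[ℝ] 𝔼 := tangentCoordChange (𝓡 d) x₀ x x with hAdef
  have hinv : ψ₀.symm (ψ₀ x) = x := ψ₀.left_inv hx
  have hA : HasFDerivAt (ψ ∘ ψ₀.symm) A (ψ₀ x) := by
    have := hasFDerivWithinAt_tangentCoordChange (I := 𝓡 d) (x := x₀) (y := x) (z := x)
      (by simpa using hx)
    rw [ModelWithCorners.range_eq_univ, hasFDerivWithinAt_univ] at this
    exact this
  have hsm : ContDiffAt ℝ 2 (ψ ∘ ψ₀.symm) (ψ₀ x) := by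
    have := contDiffWithinAt_ext_coord_change (I := 𝓡 d) (n := ∞) x x₀
      (y := extChartAt (𝓡 d) x₀ x) (by simpa [← hψ₀, hinv] using ψ₀.map_source hx)
    have hle : (2 : WithTop ℕ∞) ≤ ∞ := WithTop.coe_le_coe.2 le_top
    rw [ModelWithCorners.range_eq_univ, contDiffWithinAt_univ] at this
    exact this.of_le hle
  obtain ⟨K, hK⟩ := exists_norm_sub_sub_le_of_contDiffAt hsm hA
  obtain ⟨C, hC⟩ := hp
  have hcont : Tendsto ψ₀.symm (𝓝 (ψ₀ x)) (𝓝 x) := by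
    have := (ψ₀.continuousAt_symm (ψ₀.map_source hx)).tendsto
    rwa [hinv] at this
  obtain ⟨K', hK'⟩ := hA.differentiableAt.isBigO_sub.bound
  refine ⟨‖p‖ * K + |C / 2| * K' ^ 2, ?_⟩
  filter_upwards [hcont.eventually hC, hK, hK'] with y h1 h2 h3
  simp only [transposeGradient, LinearMap.coe_mk, AddHom.coe_mk, Function.comp_apply, hinv,
    InnerProductSpace.toDual_symm_apply,
    ContinuousLinearMap.comp_apply] at h1 h2 h3 ⊢
  refine h1.trans ?_
  have h4 : p (ψ (ψ₀.symm y) - ψ x) ≤ p (A (y - ψ₀ x)) + ‖p‖ * (K * ‖y - ψ₀ x‖ ^ 2) := by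
    have h5 := (le_abs_self _).trans (p.le_opNorm_of_le h2)
    rw [map_sub] at h5
    linarith
  have h6 : C / 2 * ‖ψ (ψ₀.symm y) - ψ x‖ ^ 2 ≤ |C / 2| * (K' * ‖y - ψ₀ x‖) ^ 2 := by
    gcongr
    exact le_abs_self _
  change _ + p (ψ (ψ₀.symm y) - ψ x) + _ ≤ _
  linarith

/-- The derivative of the coordinate change is invertible, so its transpose is injective and
preserves dimension. -/
theorem dimSuperdifferential_le_finrank_proximalSupergradients (φ : M → ℝ) {x₀ x : M}
    (hx : x ∈ (chartAt 𝔼 x₀).source) :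
    dimSuperdifferential d φ x ≤ Module.finrank ℝ (vectorSpan ℝ
      (proximalSupergradients (φ ∘ (chartAt 𝔼 x₀).symm) (chartAt 𝔼 x₀ x))) := by
  let Φ : (TangentSpace (𝓡 d) x →L[ℝ] ℝ) →ₗ[ℝ] 𝔼 :=
    transposeGradient (tangentCoordChange (𝓡 d) x₀ x x)
  have hΦ : Function.Injective Φ := by
    refine transposeGradient_injective fun v => ⟨tangentCoordChange (𝓡 d) x x₀ x v, ?_⟩
    rw [tangentCoordChange_comp (by simpa using hx), tangentCoordChange_self (by simp)]
  have himage : Φ '' superdifferential d φ x ⊆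
      proximalSupergradients (φ ∘ (chartAt 𝔼 x₀).symm) (chartAt 𝔼 x₀ x) := by
    rintro _ ⟨p, hp, rfl⟩
    exact transposeGradient_mem_proximalSupergradients d hx hp
  have hmap : (vectorSpan ℝ (superdifferential d φ x)).map Φ =
      vectorSpan ℝ (Φ '' superdifferential d φ x) :=
    Φ.toAffineMap.map_vectorSpan (s := superdifferential d φ x)
  unfold dimSuperdifferential
  rw [(Submodule.equivMapOfInjective Φ hΦ _).finrank_eq, hmap]
  exact Submodule.finrank_mono (vectorSpan_mono ℝ himage)

/-- The dimension bound for `Σ^{≥ k}(φ)`. Since the proximal supergradients of any function are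
locally monotone up to a multiple of the identity, semiconcavity of `φ` is not used: it serves to
make the superdifferential non-empty. -/
theorem hasSmallInductiveDimensionLT_sigmaGE [RegularSpace M] (φ : M → ℝ) {k n : ℕ}
    (hn : d < n + k) : HasSmallInductiveDimensionLT (sigmaGE d k φ) n := by
  refine hasSmallInductiveDimensionLT_of_locally fun x₀ => ?_
  let ψ₀ := chartAt 𝔼 (x₀ : M)
  let U : Set (sigmaGE d k φ) := (↑) ⁻¹' ψ₀.source
  refine ⟨U, ψ₀.open_source.preimage continuous_subtype_val, mem_chart_source 𝔼 (x₀ : M), ?_⟩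
  let ι : U → ψ₀.source := fun y => ⟨(y : sigmaGE d k φ), y.2⟩
  have hι : IsInducing ι := by
    refine .of_comp (g := ((↑) : ψ₀.source → M)) ?_ continuous_subtype_val ?_
    · exact Continuous.subtype_mk (continuous_subtype_val.comp continuous_subtype_val) _
    · have : IsInducing (Subtype.val ∘ Subtype.val : U → M) :=
        IsInducing.subtypeVal.comp IsInducing.subtypeVal
      exact this
  have hψ : IsInducing (fun y : U => ψ₀ (y : sigmaGE d k φ)) :=
    ψ₀.isOpenEmbedding_restrict.isInducing.comp hι
  refine hasSmallInductiveDimensionLT_of_hausdorffMeasure_range hψ (measure_mono_null ?_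
    (hausdorffMeasure_setOf_le_finrank_proximalSupergradients (φ ∘ ψ₀.symm) k n (by simpa using hn)))
  rintro _ ⟨y, rfl⟩
  exact le_trans y.1.2 (dimSuperdifferential_le_finrank_proximalSupergradients d φ y.2)

end Manifold

end Semiconcave


theorem mainTheorem5 (d : ℕ) {M : Type*} [TopologicalSpace M] [T2Space M] [CompactSpace M]
    [ConnectedSpace M] [ChartedSpace (EuclideanSpace ℝ (Fin d)) M] [IsManifold (𝓡 d) ∞ M]
    (φ : M → ℝ) (hφ : φ ∈ Semiconcave.SCL d M) (k : ℕ) (hk : k ≤ d) :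
    smallInductiveDimension (Semiconcave.sigmaGE d k φ) ≤ ((d - k : ℕ) : WithBot ℕ∞) :=
  smallInductiveDimension_le_iff.2
    (Semiconcave.hasSmallInductiveDimensionLT_sigmaGE d φ (by omega))
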